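/- Let $\mathcal O$ be a Dedekind domain of characteristic $0$ with fraction field $K$, let $\mathfrak p$ be a maximal ideal of $\mathcal O$ whose residue field $k=\mathcal O/\mathfrak p$ has characteristic $p>0$, and let $\mathcal O_{\mathfrak p}$ be the localization of $\mathcal O$ at $\mathfrak p$. For a finite group $G$ let $\mathcal R(G)$ be the character ring of $G$ over $K$ (the Grothendieck ring of the category of finite-dimensional $KG$-modules, viewed as a ring of class functions $G\to K$), and let $\mathcal O_{\mathfrak p}\mathcal R(G)=\mathcal O_{\mathfrak p}\otimes_{\mathbb Z}\mathcal R(G)$, identified with the $\mathcal O_{\mathfrak p}$-span of the characters of $G$ in the space of class functions $G\to K$. A $p$-element is an element whose order is a power of $p$. Let $e_1^G:G\to K$ be the characteristic function of the set of $p$-elements of $G$, and let $\mathcal R_{\mathfrak p}(G,1)=\mathcal O_{\mathfrak p}\mathcal R(G)\,e_1^G$ be the principal block, an $\mathcal O_{\mathfrak p}$-algebra under pointwise operations with unit $e_1^G$. A subgroup $H\le G$ *controls the fusion of $p$-elements* of $G$ if any two $p$-elements of $H$ which are conjugate in $G$ are conjugate in $H$. Let $G$ be a finite group and $H$ a subgroup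 of $G$, and assume that $K$ and $k$ are splitting fields for $G$ and for $H$. (1) If the index of $H$ in $G$ is prime to $p$ and $H$ controls the fusion of $p$-elements of $G$, then restriction of functions from $G$ to $H$ is an isomorphism of $\mathcal O_{\mathfrak p}$-algebras $$\operatorname{Res}^G_H:\mathcal R_{\mathfrak p}(G,1)\xrightarrow{\ \sim\ }\mathcal R_{\mathfrak p}(H,1).$$ (2) If $P$ is an abelian Sylow $p$-subgroup of $G$ and $H=N_G(P)$, then $H$ has index prime to $p$ in $G$ and controls the fusion of $p$-elements of $G$; hence $\operatorname{Res}^G_H:\mathcal R_{\mathfrak p}(G,1)\to\mathcal R_{\mathfrak p}(H,1)$ is an isomorphism of $\mathcal O_{\mathfrak p}$-algebras. (3) If $G=H\ltimes N$ with $N$ a normal subgroup of $G$ of order prime to $p$, then $H$ has index prime to $p$ in $G$ and controls the fusion of $p$-elements of $G$; hence $\operatorname{Res}^G_H:\mathcal R_{\mathfrak p}(G,1)\to\mathcal R_{\mathfrak p}(H,1)$ is an isomorphism of $\mathcal O_{\mathfrak p}$-algebras. -/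

import Mathlib

namespace CharRing

/-- `F` is a splitting field for `G`: every finite-dimensional irreducible representation of `G`
over `F` has only scalar endomorphisms. -/
def IsSplittingFieldFor (F : Type*) [Field F] (G : Type*) [Group G] : Prop :=
  ∀ (n : ℕ) (ρ : Representation F G (Fin n → F)), ρ.IsIrreducible →
    Function.Surjective (algebraMap F (Representation.IntertwiningMap ρ ρ))

/-- A `p`-element: an element whose order is a power of `p` (the identity is one). -/
def IsPElement {G : Type*} [Group G] (p : ℕ) (g : G) : Prop :=
  ∃ n : ℕ, orderOf g = p ^ n

/-- `H` controls the fusion of `p`-elements in `G`: two `p`-elements of `H` which are conjugate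
in `G` are already conjugate in `H`. -/
def ControlsFusion {G : Type*} [Group G] (p : ℕ) (H : Subgroup G) : Prop :=
  ∀ x y : H, IsPElement p x → IsPElement p y → IsConj (x : G) (y : G) → IsConj x y

/-- The characters of the finite-dimensional representations of `G` over `K`. -/
def characters (K : Type*) [Field K] (G : Type*) [Group G] : Set (G → K) :=
  {χ | ∃ (n : ℕ) (ρ : Representation K G (Fin n → K)), χ = ρ.character}

theorem character_mem_characters {K : Type*} [Field K] {G : Type*} [Group G]
    {V : Type*} [AddCommGroup V] [Module K V] [FiniteDimensional K V]
    (ρ : Representation K G V) : ρ.character ∈ characters K G := by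
  let e : V ≃ₗ[K] (Fin (Module.finrank K V) → K) := (Module.finBasis K V).equivFun
  refine ⟨Module.finrank K V,
    { toFun := fun g => e.conj (ρ g)
      map_one' := by rw [map_one]; exact e.conj_id
      map_mul' := fun g h => by rw [map_mul]; exact e.conj_comp _ _ }, ?_⟩
  funext g
  exact (LinearMap.trace_conj' (ρ g) e).symm

theorem one_mem_characters (K : Type*) [Field K] (G : Type*) [Group G] :
    (1 : G → K) ∈ characters K G := by
  have h := character_mem_characters (Representation.trivial K G K)
  convert h using 1
  funext g
  simp [Representation.character, Representation.trivial]

theorem mul_mem_characters {K : Type*} [Field K] {G : Type*} [Group G] {f f' : G → K}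
    (hf : f ∈ characters K G) (hf' : f' ∈ characters K G) : f * f' ∈ characters K G := by
  obtain ⟨n, ρ, rfl⟩ := hf
  obtain ⟨m, σ, rfl⟩ := hf'
  rw [← Representation.char_tensor]
  exact character_mem_characters _

theorem comp_subtype_mem_characters {K : Type*} [Field K] {G : Type*} [Group G] (H : Subgroup G)
    {f : G → K} (hf : f ∈ characters K G) : (fun h : H => f h) ∈ characters K H := by
  obtain ⟨n, ρ, rfl⟩ := hf
  exact ⟨n, ρ.comp H.subtype, rfl⟩

/-- The character ring `A𝓡(G)` of `G` with coefficients in `A`, where `𝓡(G)` is the Grothendieck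
ring of the category of finite-dimensional `K G`-modules, viewed inside the functions `G → K`:
the `A`-span of all characters. (In characteristic zero characters are sums of irreducible ones,
which are linearly independent over `K`; so for `A ⊆ K` this is `A ⊗ 𝓡(G)`.) -/
def charRing (A K G : Type*) [CommRing A] [Field K] [Algebra A K] [Group G] :
    Subalgebra A (G → K) :=
  (Submodule.span A (characters K G)).toSubalgebra
    (Submodule.subset_span (one_mem_characters K G))
    (fun x y hx hy => by
      have h := Submodule.mul_mem_mul hx hy
      rw [Submodule.span_mul_span] at h
      refine Submodule.span_mono ?_ h
      rintro _ ⟨a, ha, b, hb, rfl⟩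
      exact mul_mem_characters ha hb)

open Classical in
/-- The idempotent `e₁`: the characteristic function of the set of `p`-elements of `G`
(the `p'`-section of `1`). -/
noncomputable def e₁ (K G : Type*) [Field K] [Group G] (p : ℕ) : G → K :=
  fun g => if IsPElement p g then 1 else 0

theorem e₁_mul_self (K G : Type*) [Field K] [Group G] (p : ℕ) :
    e₁ K G p * e₁ K G p = e₁ K G p := by
  funext g
  simp [e₁]

/-- The set `A𝓡(G) e₁` of all `f * e₁` with `f ∈ A𝓡(G)`. -/
def blockSubalgebra (A K G : Type*) [CommRing A] [Field K] [Algebra A K] [Group G] (p : ℕ) :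
    NonUnitalSubalgebra A (G → K) where
  carrier := {f | ∃ f₀ ∈ charRing A K G, f = f₀ * e₁ K G p}
  zero_mem' := ⟨0, zero_mem _, by simp⟩
  add_mem' := by
    rintro _ _ ⟨a, ha, rfl⟩ ⟨b, hb, rfl⟩
    exact ⟨a + b, add_mem ha hb, by rw [add_mul]⟩
  mul_mem' := by
    rintro _ _ ⟨a, ha, rfl⟩ ⟨b, hb, rfl⟩
    exact ⟨a * b, mul_mem ha hb, by rw [mul_mul_mul_comm, e₁_mul_self]⟩
  smul_mem' := by
    rintro c _ ⟨a, ha, rfl⟩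
    exact ⟨c • a, Subalgebra.smul_mem _ ha c, by rw [smul_mul_assoc]⟩

/-- The principal block `𝓡_𝔭(G, 1) = A𝓡(G) e₁` (for `A = 𝒪_𝔭`). Addition, multiplication and
scalar multiplication are pointwise; the unit element is `e₁`. -/
def PrincipalBlock (A K G : Type*) [CommRing A] [Field K] [Algebra A K] [Group G] (p : ℕ) :
    Type _ :=
  blockSubalgebra A K G p

section

variable (A K G : Type*) [CommRing A] [Field K] [Algebra A K] [Group G] (p : ℕ)

instance : NonUnitalCommRing (PrincipalBlock A K G p) :=
  inferInstanceAs (NonUnitalCommRing (blockSubalgebra A K G p))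

noncomputable instance : One (PrincipalBlock A K G p) :=
  ⟨⟨e₁ K G p, 1, one_mem _, (one_mul _).symm⟩⟩

variable {A K G p} in
protected theorem PrincipalBlock.one_mul (x : PrincipalBlock A K G p) : 1 * x = x := by
  obtain ⟨_, a, ha, rfl⟩ := x
  refine Subtype.ext ?_
  change e₁ K G p * (a * e₁ K G p) = a * e₁ K G p
  rw [mul_left_comm, e₁_mul_self]

noncomputable instance : CommRing (PrincipalBlock A K G p) :=
  { (inferInstance : NonUnitalCommRing (PrincipalBlock A K G p)),
    (inferInstance : One (PrincipalBlock A K G p)) with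
    one_mul := PrincipalBlock.one_mul
    mul_one := fun x => by rw [mul_comm]; exact PrincipalBlock.one_mul x }

instance : Module A (PrincipalBlock A K G p) :=
  inferInstanceAs (Module A (blockSubalgebra A K G p))

noncomputable instance : Algebra A (PrincipalBlock A K G p) :=
  Algebra.ofModule
    (fun r x y => Subtype.ext (smul_mul_assoc r (x.1 : G → K) (y.1 : G → K)))
    (fun r x y => Subtype.ext (mul_smul_comm r (x.1 : G → K) (y.1 : G → K)))

end

theorem isPElement_coe {G : Type*} [Group G] (p : ℕ) (H : Subgroup G) (h : H) :
    IsPElement p (h : G) ↔ IsPElement p h := by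
  simp [IsPElement]

theorem comp_subtype_mem_charRing {A K G : Type*} [CommRing A] [Field K] [Algebra A K] [Group G]
    (H : Subgroup G) {f : G → K} (hf : f ∈ charRing A K G) :
    (fun h : H => f h) ∈ charRing A K H := by
  change f ∈ Submodule.span A (characters K G) at hf
  change _ ∈ Submodule.span A (characters K H)
  induction hf using Submodule.span_induction with
  | mem x hx => exact Submodule.subset_span (comp_subtype_mem_characters H hx)
  | zero => exact zero_mem _
  | add x y _ _ hx hy => exact add_mem hx hy
  | smul a x _ hx => exact Submodule.smul_mem _ a hx

theorem e₁_comp_subtype {K G : Type*} [Field K] [Group G] (p : ℕ) (H : Subgroup G) (h : H) :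
    e₁ K G p h = e₁ K H p h := by
  have hh := isPElement_coe p H h
  by_cases h₁ : IsPElement p h
  · simp [e₁, h₁, hh.2 h₁]
  · simp [e₁, h₁, mt hh.1 h₁]

/-- Restriction of functions from `G` to the subgroup `H`, as a homomorphism of `A`-algebras
`𝓡_𝔭(G, 1) → 𝓡_𝔭(H, 1)`. -/
noncomputable def res (A K : Type*) {G : Type*} [CommRing A] [Field K] [Algebra A K] [Group G] (p : ℕ)
    (H : Subgroup G) : PrincipalBlock A K G p →ₐ[A] PrincipalBlock A K H p :=
  AlgHom.ofLinearMap
    { toFun := fun f => ⟨fun h : H => f.1 h, by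
        obtain ⟨_, f₀, hf₀, rfl⟩ := f
        exact ⟨_, comp_subtype_mem_charRing H hf₀, funext fun h => by
          simp [e₁_comp_subtype]⟩⟩
      map_add' := fun _ _ => rfl
      map_smul' := fun _ _ => rfl }
    (Subtype.ext (funext fun h => e₁_comp_subtype p H h))
    (fun _ _ => rfl)

end CharRing

/-! A `p`-element `x` generates a `p`-group, so its number of fixed points on `G ⧸ H` is congruent
to the index of `H` modulo `p`, hence prime to `p`. Injectivity: a fixed point exists, so `x` is
conjugate into `H`, and class functions supported on `p`-elements are determined on `H`.
Surjectivity: let `π` be the character induced from the trivial one; `π x` is that number of fixed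
points. Fusion control gives `Ind f = f * π` at the `p`-elements of `H`. The values of `π` at
`p`-elements are finitely many integers invertible in `A`, so some `ψ` in the character ring of `G`
inverts `π` there (`exists_mul_eq_one_of_isUnit`), and `Ind f * ψ * e₁` restricts to `f * e₁`. Part
(2) rests on Burnside's fusion theorem, part (3) on the retraction of `G` onto `H` with kernel `N`.
-/

namespace CharRing

/-! ### Traces of block-monomial maps. -/

section Trace

variable {K : Type*} [Field K]

/-- The trace of a block-monomial endomorphism `f ↦ (x ↦ a x (f (s x)))` of `ι → Kⁿ`. -/
theorem trace_blockMonomial {ι : Type*} [Fintype ι] [DecidableEq ι] {n : ℕ}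
    (a : (Fin n → K) →ₗ[K] (Fin n → K)) (s : ι → ι)
    (T : (ι → Fin n → K) →ₗ[K] (ι → Fin n → K)) (hT : ∀ f x, T f x = a (f (s x))) :
    LinearMap.trace K _ T = ∑ x, if s x = x then LinearMap.trace K _ a else 0 := by
  rw [LinearMap.trace_eq_matrix_trace K (Pi.basis fun _ : ι => Pi.basisFun K (Fin n)),
    Matrix.trace, Fintype.sum_sigma]
  refine Finset.sum_congr rfl fun x _ => ?_
  rw [LinearMap.trace_eq_matrix_trace K (Pi.basisFun K (Fin n)), Matrix.trace]
  split_ifs with h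
  · refine Finset.sum_congr rfl fun i _ => ?_
    simp [LinearMap.toMatrix_apply, hT, h]
  · refine Finset.sum_eq_zero fun i _ => ?_
    simp [LinearMap.toMatrix_apply, hT, h]

end Trace

/-! ### Induced representations and their characters. -/

section Induction

open Classical in
/-- The induced class function `g ↦ |H|⁻¹ ∑ₓ f (x g x⁻¹)`, the sum being over those `x` with
`x g x⁻¹ ∈ H`. -/
noncomputable def ind (A K : Type*) {G : Type*} [CommRing A] [Field K] [Algebra A K] [Group G]
    [Fintype G] (H : Subgroup G) : (H → K) →ₗ[A] (G → K) where
  toFun f g := (Nat.card H : K)⁻¹ * ∑ x : G, ∑ h : H, if x * g = h * x then f h else 0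
  map_add' f f' := by
    funext g
    simp only [Pi.add_apply, ← mul_add, ← Finset.sum_add_distrib]
    congr 1
    refine Finset.sum_congr rfl fun x _ => Finset.sum_congr rfl fun h _ => ?_
    split_ifs <;> simp
  map_smul' c f := by
    funext g
    simp only [Pi.smul_apply, RingHom.id_apply, ← mul_smul_comm, Finset.smul_sum]
    congr 1
    refine Finset.sum_congr rfl fun x _ => Finset.sum_congr rfl fun h _ => ?_
    split_ifs <;> simp

variable {K : Type*} [Field K] {G : Type*} [Group G] (H : Subgroup G)

/-- For a representation of `H` on `V`, the action of `H` on the functions `G → V` whose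
invariants form the induced representation. -/
def leftRep {V : Type*} [AddCommGroup V] [Module K V] (ρ : Representation K H V) :
    Representation K H (G → V) where
  toFun h :=
    { toFun := fun f x => ρ h (f ((h : G)⁻¹ * x))
      map_add' := fun f f' => by funext x; simp
      map_smul' := fun c f => by funext x; simp }
  map_one' := by ext; simp
  map_mul' h h' := by
    refine LinearMap.ext fun f => funext fun x => ?_
    simp [mul_assoc]

/-- The action of `G` on the functions on `G` by right translation. -/
def rightRep (K G V : Type*) [Field K] [Group G] [AddCommGroup V] [Module K V] :
    Representation K G (G → V) where
  toFun g :=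
    { toFun := fun f x => f (x * g)
      map_add' := fun f f' => rfl
      map_smul' := fun c f => rfl }
  map_one' := by
    refine LinearMap.ext fun f => funext fun x => ?_
    simp
  map_mul' g g' := by
    refine LinearMap.ext fun f => funext fun x => ?_
    simp [mul_assoc]

theorem rightRep_mem_invariants {V : Type*} [AddCommGroup V] [Module K V]
    (ρ : Representation K H V) (g : G) {f : G → V} (hf : f ∈ (leftRep H ρ).invariants) :
    rightRep K G V g f ∈ (leftRep H ρ).invariants := by
  intro h
  funext x
  have := congrFun (hf h) (x * g)
  simpa [leftRep, rightRep, mul_assoc] using this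

/-- The induced representation. -/
noncomputable def indRep {V : Type*} [AddCommGroup V] [Module K V] (ρ : Representation K H V) :
    Representation K G (leftRep H ρ).invariants where
  toFun g := (rightRep K G V g).restrict fun _ hf => rightRep_mem_invariants H ρ g hf
  map_one' := by
    refine LinearMap.ext fun f => Subtype.ext ?_
    simp [LinearMap.restrict_apply]
  map_mul' g g' := by
    refine LinearMap.ext fun f => Subtype.ext ?_
    simp [LinearMap.restrict_apply]

/-- Averaging over `H` projects `G → V` onto the invariants, so the trace of `g` there is the trace
on all of `G → V` of right translation after averaging. Each summand is block-monomial. -/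
theorem character_indRep (A : Type*) [CommRing A] [Algebra A K] [Fintype G] [CharZero K] {n : ℕ}
    (ρ : Representation K H (Fin n → K)) :
    (indRep H ρ).character = ind A K H ρ.character := by
  classical
  funext g
  have hcard : (Nat.card H : K) ≠ 0 := Nat.cast_ne_zero.2 Nat.card_pos.ne'
  set τ := leftRep H ρ
  set E : (G → Fin n → K) →ₗ[K] (G → Fin n → K) := (Nat.card H : K)⁻¹ • ∑ h, τ h with hE
  have hEmem : ∀ f, E f ∈ τ.invariants := by
    intro f h
    simp only [hE, LinearMap.smul_apply, LinearMap.sum_apply, map_smul, map_sum]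
    congr 1
    refine Fintype.sum_equiv (Equiv.mulLeft h) _ _ fun h' => ?_
    simp [map_mul]
  have hEid : ∀ f ∈ τ.invariants, E f = f := by
    intro f hf
    have hf' : ∀ h, τ h f = f := hf
    simp only [hE, LinearMap.smul_apply, LinearMap.sum_apply, hf', Finset.sum_const,
      Finset.card_univ, ← Nat.card_eq_fintype_card]
    rw [← Nat.cast_smul_eq_nsmul K, smul_smul, inv_mul_cancel₀ hcard, one_smul]
  have hmem : ∀ f, (rightRep K G _ g ∘ₗ E) f ∈ τ.invariants := fun f =>
    rightRep_mem_invariants H ρ g (hEmem f)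
  have key := LinearMap.trace_restrict_eq_of_forall_mem τ.invariants _ hmem
  have hres : (rightRep K G _ g ∘ₗ E).restrict (fun x _ => hmem x) = indRep H ρ g := by
    refine LinearMap.ext fun f => Subtype.ext ?_
    simp [indRep, LinearMap.restrict_apply, hEid f f.2]
  rw [hres] at key
  rw [Representation.character, key, hE, LinearMap.comp_smul, map_smul, smul_eq_mul]
  change _ = (Nat.card H : K)⁻¹ * _
  congr 1
  rw [Finset.sum_comm]
  have hsum : rightRep K G (Fin n → K) g ∘ₗ ∑ h, τ h = ∑ h, rightRep K G _ g ∘ₗ τ h := by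
    ext; simp
  rw [hsum, map_sum]
  refine Finset.sum_congr rfl fun h _ => ?_
  rw [trace_blockMonomial (ρ h) (fun x => (h : G)⁻¹ * (x * g)) _ fun f x => rfl]
  refine Finset.sum_congr rfl fun x _ => ?_
  simp only [inv_mul_eq_iff_eq_mul]
  rfl

theorem ind_mem_charRing {A : Type*} [CommRing A] [Algebra A K] [Fintype G] [CharZero K]
    {f : H → K} (hf : f ∈ charRing A K H) : ind A K H f ∈ charRing A K G := by
  change f ∈ Submodule.span A (characters K H) at hf
  change _ ∈ Submodule.span A (characters K G)
  induction hf using Submodule.span_induction with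
  | mem x hx =>
    obtain ⟨n, ρ, rfl⟩ := hx
    rw [← character_indRep]
    exact Submodule.subset_span (character_mem_characters _)
  | zero => simp
  | add x y _ _ hx hy => rw [map_add]; exact add_mem hx hy
  | smul a x _ hx => rw [map_smul]; exact Submodule.smul_mem _ a hx

theorem apply_eq_of_isConj {A : Type*} [CommRing A] [Algebra A K] {f : G → K}
    (hf : f ∈ charRing A K G) {x y : G} (hxy : IsConj x y) : f x = f y := by
  change f ∈ Submodule.span A (characters K G) at hf
  obtain ⟨c, rfl⟩ := isConj_iff.1 hxy
  induction hf using Submodule.span_induction with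
  | mem f hf =>
    obtain ⟨n, ρ, rfl⟩ := hf
    exact (ρ.char_conj x c).symm
  | zero => rfl
  | add f f' _ _ h h' => simp [h, h']
  | smul a f _ h => simp [h]

end Induction

/-! ### Fixed points of `p`-elements on `G ⧸ H`. -/

section PElement

variable {G : Type*} [Group G] {p : ℕ}

theorem IsPElement.of_isConj {x y : G} (hx : IsPElement p x) (hxy : IsConj x y) :
    IsPElement p y := by
  obtain ⟨c, rfl⟩ := isConj_iff.1 hxy
  obtain ⟨n, hn⟩ := hx
  exact ⟨n, by
    rw [← hn]
    exact orderOf_injective (MulAut.conj c).toMonoidHom (MulAut.conj c).injective x⟩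

theorem IsPElement.isPGroup_zpowers {x : G} (hx : IsPElement p x) :
    IsPGroup p (Subgroup.zpowers x) := by
  obtain ⟨n, hn⟩ := hx
  exact IsPGroup.of_card (n := n) (by rw [Nat.card_zpowers, hn])

theorem card_fixedBy_modEq [Fact p.Prime] {α : Type*} [MulAction G α] [Finite α] {x : G}
    (hx : IsPElement p x) : Nat.card α ≡ Nat.card (MulAction.fixedBy α x) [MOD p] := by
  have h := hx.isPGroup_zpowers.card_modEq_card_fixedPoints α
  have heq : MulAction.fixedPoints (Subgroup.zpowers x) α = MulAction.fixedBy α x := by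
    ext a
    constructor
    · intro ha
      exact ha ⟨x, Subgroup.mem_zpowers x⟩
    · rintro ha ⟨y, hy⟩
      exact (Subgroup.zpowers_le.2 (MulAction.mem_stabilizer_iff.2 ha) :
        Subgroup.zpowers x ≤ MulAction.stabilizer G a) hy
  rwa [heq] at h

theorem not_dvd_card_fixedBy [Fact p.Prime] [Finite G] {H : Subgroup G} (hH : p.Coprime H.index)
    {x : G} (hx : IsPElement p x) : ¬ p ∣ Nat.card (MulAction.fixedBy (G ⧸ H) x) := by
  rw [← (card_fixedBy_modEq (α := G ⧸ H) hx).dvd_iff dvd_rfl]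
  exact ((Fact.out : p.Prime).coprime_iff_not_dvd).1 hH

theorem mk_mem_fixedBy_iff {H : Subgroup G} {x g : G} :
    (g : G ⧸ H) ∈ MulAction.fixedBy (G ⧸ H) x ↔ g⁻¹ * x * g ∈ H := by
  rw [MulAction.mem_fixedBy, eq_comm, MulAction.Quotient.smul_coe, QuotientGroup.eq, smul_eq_mul,
    mul_assoc]

theorem exists_isConj_mem [Fact p.Prime] [Finite G] {H : Subgroup G} (hH : p.Coprime H.index)
    {x : G} (hx : IsPElement p x) : ∃ h : H, IsConj x (h : G) := by
  have hne : Nat.card (MulAction.fixedBy (G ⧸ H) x) ≠ 0 := fun h0 =>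
    not_dvd_card_fixedBy hH hx (h0 ▸ dvd_zero p)
  obtain ⟨⟨q, hq⟩⟩ := (Nat.card_ne_zero.1 hne).1
  obtain ⟨g, rfl⟩ := QuotientGroup.mk_surjective q
  exact ⟨⟨_, mk_mem_fixedBy_iff.1 hq⟩, isConj_iff.2 ⟨g⁻¹, by simp⟩⟩

variable {K : Type*} [Field K] {A : Type*} [CommRing A] [Algebra A K] [Fintype G] (H : Subgroup G)

theorem ind_one_apply [CharZero K] (x : G) :
    ind A K H 1 x = Nat.card (MulAction.fixedBy (G ⧸ H) x) := by
  classical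
  have hcard : (Nat.card H : K) ≠ 0 := Nat.cast_ne_zero.2 Nat.card_pos.ne'
  change (Nat.card H : K)⁻¹ * ∑ g : G, ∑ h : H, (if g * x = h * g then (1 : K) else 0) = _
  -- Each fixed coset has `|H|` representatives, which cancels the normalising factor. Inverting the
  -- summation variable turns `g * x * g⁻¹ ∈ H` into the condition that `x` fixes `gH`.
  rw [inv_mul_eq_iff_eq_mul₀ hcard, ← Nat.cast_mul, ← QuotientGroup.card_preimage_mk,
    ← Equiv.sum_comp (Equiv.inv G), Nat.card_eq_fintype_card, Fintype.card_subtype,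
    Finset.card_filter, Nat.cast_sum]
  refine Finset.sum_congr rfl fun g _ => ?_
  have hiff : ∀ h : H, (Equiv.inv G g * x = h * Equiv.inv G g ↔ g⁻¹ * x * g = h) := fun h => by
    simp [← eq_mul_inv_iff_mul_eq]
  simp only [hiff, Set.mem_preimage, mk_mem_fixedBy_iff]
  by_cases hg : g⁻¹ * x * g ∈ H
  · rw [Finset.sum_eq_single (⟨_, hg⟩ : H)]
    · simp [hg]
    · intro h _ hne
      exact if_neg fun h' => hne (Subtype.ext h'.symm)
    · simp
  · simp only [hg, if_false, Nat.cast_zero]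
    exact Finset.sum_eq_zero fun h _ => if_neg fun h' : _ = _ => hg (by rw [h']; exact h.2)

/-- Every `h` in `H` contributing to the sum is a `p`-element conjugate to `y` in `G`, hence in `H`,
so `f h = f y` factors out. -/
theorem ind_apply_of_controlsFusion (hH : ControlsFusion p H) {f : H → K}
    (hf : f ∈ charRing A K H) {y : H} (hy : IsPElement p y) :
    ind A K H f y = f y * ind A K H 1 y := by
  classical
  change (Nat.card H : K)⁻¹ * _ = f y * ((Nat.card H : K)⁻¹ * _)
  rw [mul_left_comm]
  congr 1
  rw [Finset.mul_sum]
  refine Finset.sum_congr rfl fun x _ => ?_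
  rw [Finset.mul_sum]
  refine Finset.sum_congr rfl fun h _ => ?_
  split_ifs with hx
  · have hc : IsConj (y : G) (h : G) := isConj_iff.2 ⟨x, by rw [hx, mul_inv_cancel_right]⟩
    have hh : IsPElement p h :=
      (isPElement_coe p H h).1 (((isPElement_coe p H y).2 hy).of_isConj hc)
    rw [apply_eq_of_isConj hf (hH y h hy hh hc)]
    simp
  · simp

end PElement

/-! ### Bijectivity of restriction. -/

section Bijective

/-- An element `π` of a subalgebra `S` of `X → K` has an inverse in `S` on the set of points where
its values lie in a given finite set of natural numbers invertible in `A`. -/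
theorem exists_mul_eq_one_of_isUnit {A K X : Type*} [CommRing A] [Field K] [Algebra A K]
    (S : Subalgebra A (X → K)) {π : X → K} (hπ : π ∈ S) (T : Finset ℕ)
    (hT : ∀ m ∈ T, IsUnit (m : A)) :
    ∃ ψ ∈ S, ∀ x, (∃ m ∈ T, π x = m) → π x * ψ x = 1 := by
  classical
  induction T using Finset.induction_on with
  | empty => exact ⟨0, zero_mem _, by simp⟩
  | insert m T _ ih =>
    obtain ⟨ψ, hψ, h⟩ := ih fun k hk => hT k (Finset.mem_insert_of_mem hk)
    obtain ⟨u, hu⟩ := hT m (Finset.mem_insert_self m T)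
    have hum : algebraMap A K ↑u⁻¹ * (m : K) = 1 := by
      rw [← map_natCast (algebraMap A K), ← map_mul, ← hu, Units.inv_mul, map_one]
    -- This choice multiplies `1 - π * ψ` by `1 - u⁻¹ • π`, so in the end `1 - π * ψ` is the product
    -- of the `1 - m⁻¹ • π` over `m ∈ T`, which vanishes wherever `π` takes a value in `T`.
    refine ⟨ψ + (↑u⁻¹ : A) • ((1 : X → K) - π * ψ),
      add_mem hψ (S.smul_mem (sub_mem (one_mem _) (mul_mem hπ hψ)) _), ?_⟩
    rintro x ⟨k, hk, hx⟩
    rw [Pi.add_apply, Pi.smul_apply, Pi.sub_apply, Pi.one_apply, Pi.mul_apply, Algebra.smul_def]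
    rcases Finset.mem_insert.1 hk with rfl | hk
    · rw [hx]
      linear_combination (1 - (k : K) * ψ x) * hum
    · linear_combination (1 - algebraMap A K ↑u⁻¹ * π x) * h x ⟨k, hk, hx⟩

theorem res_bijective {A K G : Type*} [CommRing A] [Field K] [CharZero K] [Algebra A K] [Group G]
    [Finite G] {p : ℕ} [Fact p.Prime] (hA : ∀ m : ℕ, ¬ p ∣ m → IsUnit (m : A))
    {H : Subgroup G} (hindex : p.Coprime H.index) (hfusion : ControlsFusion p H) :
    Function.Bijective (res A K p H) := by
  classical
  have := Fintype.ofFinite G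
  constructor
  · rw [injective_iff_map_eq_zero]
    rintro ⟨_, f, hf, rfl⟩ h0
    refine Subtype.ext (funext fun x => ?_)
    change f x * e₁ K G p x = 0
    by_cases hx : IsPElement p x
    · obtain ⟨h, hh⟩ := exists_isConj_mem hindex hx
      have h1 : f h * e₁ K G p h = 0 := congrFun (congrArg Subtype.val h0) h
      simpa [e₁, hx, hx.of_isConj hh, apply_eq_of_isConj hf hh] using h1
    · simp [e₁, hx]
  · rintro ⟨_, f, hf, rfl⟩
    have hπ : ind A K H 1 ∈ charRing A K G := ind_mem_charRing H (one_mem _)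
    obtain ⟨ψ, hψ, h⟩ := exists_mul_eq_one_of_isUnit _ hπ
      ((Finset.range (Nat.card (G ⧸ H) + 1)).filter fun m => ¬ p ∣ m)
      fun m hm => hA m (Finset.mem_filter.1 hm).2
    refine ⟨⟨_, ind A K H f * ψ, mul_mem (ind_mem_charRing H hf) hψ, rfl⟩,
      Subtype.ext (funext fun y => ?_)⟩
    change ind A K H f y * ψ y * e₁ K G p y = f y * e₁ K H p y
    rw [e₁_comp_subtype]
    by_cases hy : IsPElement p y
    · have h1 := h y ⟨Nat.card (MulAction.fixedBy (G ⧸ H) (y : G)), Finset.mem_filter.2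
        ⟨Finset.mem_range.2 (Nat.lt_succ_of_le (Finite.card_subtype_le _)),
          not_dvd_card_fixedBy hindex ((isPElement_coe p H y).2 hy)⟩, ind_one_apply H _⟩
      rw [ind_apply_of_controlsFusion H hfusion hf hy, mul_assoc (f y), h1, mul_one]
    · simp [e₁, hy]

end Bijective

/-! ### Control of fusion in the two special cases. -/

section Fusion

variable {G : Type*} [Group G] [Finite G] {p : ℕ} [Fact p.Prime]

theorem coprime_index_normalizer (P : Sylow p G) :
    p.Coprime (Subgroup.normalizer (P : Set G)).index :=
  (Nat.Prime.coprime_iff_not_dvd Fact.out).2 fun h =>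
    P.not_dvd_index (h.trans (Subgroup.index_dvd_of_le Subgroup.le_normalizer))

/-- Every `p`-element of the normalizer lies in `P`, its normal Sylow subgroup. Burnside's theorem
then replaces the conjugating element by one normalizing `P`. -/
theorem controlsFusion_normalizer (P : Sylow p G) (hP : ∀ x ∈ P, ∀ y ∈ P, x * y = y * x) :
    ControlsFusion p (Subgroup.normalizer (P : Set G)) := by
  have hmem : ∀ x : Subgroup.normalizer (P : Set G), IsPElement p x → (x : G) ∈ P := by
    intro x hx
    have hx' := ((isPElement_coe p _ x).2 hx).isPGroup_zpowers
    have h : (x : G) ∈ Subgroup.zpowers (x : G) ⊓ Subgroup.normalizer (P : Set G) :=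
      ⟨Subgroup.mem_zpowers _, x.2⟩
    exact (hx'.inf_normalizer_sylow P ▸ h : (x : G) ∈ Subgroup.zpowers (x : G) ⊓ P).2
  have : IsMulCommutative P := ⟨⟨fun a b => Subtype.ext (hP a a.2 b b.2)⟩⟩
  intro x y hx hy hxy
  obtain ⟨c, hc⟩ := isConj_iff.1 hxy
  obtain ⟨n, hn, h⟩ := P.conj_eq_normalizer_conj_of_mem (x : G) c⁻¹ (hmem x hx)
    (by rw [inv_inv, hc]; exact hmem y hy)
  refine isConj_iff.2 ⟨⟨n⁻¹, (Subgroup.normalizer (P : Set G)).inv_mem hn⟩, Subtype.ext ?_⟩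
  rw [inv_inv, hc] at h
  simp [h]

end Fusion

theorem controlsFusion_of_isComplement' {G : Type*} [Group G] {p : ℕ} {H N : Subgroup G} (hN : N.Normal)
    (hHN : H.IsComplement' N) : ControlsFusion p H := by
  intro x y _ _ hxy
  obtain ⟨c, hc⟩ := isConj_iff.1 hxy
  obtain ⟨⟨n, h⟩, rfl⟩ := hHN.symm.2 c
  refine isConj_iff.2 ⟨h, Subtype.ext ?_⟩
  set z : H := h * x * h⁻¹
  have hz : (n : G) * z * (n : G)⁻¹ = y := by rw [← hc]; simp [z, mul_assoc]
  -- `y * z⁻¹` is the commutator `n * z * n⁻¹ * z⁻¹`, which lies in `N` by normality; being also in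
  -- `H`, it is trivial.
  have hyz : (y : G) * (z : G)⁻¹ ∈ H ⊓ N := by
    refine ⟨H.mul_mem y.2 (H.inv_mem z.2), ?_⟩
    rw [← hz, mul_assoc, mul_assoc, ← mul_assoc (z : G)]
    exact N.mul_mem n.2 (hN.conj_mem _ (N.inv_mem n.2) z)
  rw [hHN.disjoint.eq_bot, Subgroup.mem_bot, mul_inv_eq_one] at hyz
  exact hyz.symm

/-- Such an `m` is nonzero in the residue field, so it lies outside `𝔭` and is inverted by the
localization. -/
theorem isUnit_natCast_of_not_dvd {O Op : Type*} [CommRing O] (𝔭 : Ideal O) [𝔭.IsPrime]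
    [CommRing Op] [Algebra O Op] [IsLocalization.AtPrime Op 𝔭] (p : ℕ)
    [CharP 𝔭.ResidueField p] {m : ℕ} (hm : ¬ p ∣ m) : IsUnit (m : Op) := by
  rw [← map_natCast (algebraMap O Op)]
  refine IsLocalization.map_units Op (⟨(m : O), fun h => hm ?_⟩ : 𝔭.primeCompl)
  rw [← CharP.cast_eq_zero_iff 𝔭.ResidueField p, ← map_natCast (algebraMap O 𝔭.ResidueField)]
  exact Ideal.algebraMap_residueField_eq_zero.2 h

end CharRing

theorem corollary3p4
    {O Op K : Type*} [CommRing O] [IsDedekindDomain O] [CharZero O]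
    (𝔭 : Ideal O) [𝔭.IsMaximal]
    [Field K] [Algebra O K] [IsFractionRing O K]
    [CommRing Op] [Algebra O Op] [IsLocalization.AtPrime Op 𝔭]
    [Algebra Op K] [IsScalarTower O Op K]
    (p : ℕ) [Fact p.Prime] [CharP 𝔭.ResidueField p]
    {G : Type*} [Group G] [Finite G]
    (hK : CharRing.IsSplittingFieldFor K G)
    (hk : CharRing.IsSplittingFieldFor 𝔭.ResidueField G) :
    -- a subgroup of index prime to `p` which controls the fusion of `p`-elements
    (∀ H : Subgroup G,
      CharRing.IsSplittingFieldFor K H → CharRing.IsSplittingFieldFor 𝔭.ResidueField H →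
      p.Coprime H.index → CharRing.ControlsFusion p H →
      Function.Bijective (CharRing.res Op K p H)) ∧
    -- the normalizer of an abelian Sylow `p`-subgroup
    (∀ P : Sylow p G, (∀ x ∈ P, ∀ y ∈ P, x * y = y * x) →
      p.Coprime (Subgroup.normalizer (P : Set G)).index ∧
      CharRing.ControlsFusion p (Subgroup.normalizer (P : Set G)) ∧
      (CharRing.IsSplittingFieldFor K (Subgroup.normalizer (P : Set G)) →
        CharRing.IsSplittingFieldFor 𝔭.ResidueField (Subgroup.normalizer (P : Set G)) →
        Function.Bijective (CharRing.res Op K p (Subgroup.normalizer (P : Set G))))) ∧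
    -- a complement of a normal `p'`-subgroup
    (∀ H N : Subgroup G, N.Normal → H.IsComplement' N → p.Coprime (Nat.card N) →
      p.Coprime H.index ∧
      CharRing.ControlsFusion p H ∧
      (CharRing.IsSplittingFieldFor K H → CharRing.IsSplittingFieldFor 𝔭.ResidueField H →
        Function.Bijective (CharRing.res Op K p H))) := by

  have : CharZero K := charZero_of_injective_algebraMap (IsFractionRing.injective O K)
  have hA : ∀ m : ℕ, ¬ p ∣ m → IsUnit (m : Op) := fun m hm =>
    CharRing.isUnit_natCast_of_not_dvd 𝔭 p hm
  refine ⟨fun H _ _ hi hf => CharRing.res_bijective hA hi hf, fun P hP => ?_,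
    fun H N hN hHN hcard => ?_⟩
  · have hi := CharRing.coprime_index_normalizer P
    have hf := CharRing.controlsFusion_normalizer P hP
    exact ⟨hi, hf, fun _ _ => CharRing.res_bijective hA hi hf⟩
  · have hi : p.Coprime H.index := by rwa [hHN.symm.index_eq_card]
    have hf : CharRing.ControlsFusion p H := CharRing.controlsFusion_of_isComplement' hN hHN
    exact ⟨hi, hf, fun _ _ => CharRing.res_bijective hA hi hf⟩
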